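/- All graphs are finite and simple. Let $S_4$ be the symmetric group on $\{1,2,3,4\}$ and let $S\subseteq S_4$. An $S$-labeling of a graph $G$ is a pair $(D,\sigma)$, where $D$ is an orientation of $G$ and $\sigma$ assigns to each arc $e$ of $D$ a permutation $\sigma_e\in S$. A proper $4$-colouring of $(D,\sigma)$ is a map $f:V(G)\to\{1,2,3,4\}$ such that $\sigma_e(f(x))\neq f(y)$ for every arc $e=(x,y)$ of $D$. A nonempty set $S\subseteq S_4$ is called good if for every planar graph $G$, every $S$-labeling of $G$ has a proper $4$-colouring; otherwise $S$ is called bad. Theorem. Let $S$ be a subset of $S_4$ that contains the identity $\mathrm{id}$. If $S\neq\{\mathrm{id}\}$, then $S$ is bad; that is, there are a planar graph $G$ and an $S$-labeling $(D,\sigma)$ of $G$ that has no proper $4$-colouring. -/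

import Mathlib

/-- The set `A` is a (simple) arc in the plane `ℝ × ℝ` with end points `p` and `q`:
an injective continuous image of the closed unit interval. -/
def IsPlaneArc (A : Set (ℝ × ℝ)) (p q : ℝ × ℝ) : Prop :=
  ∃ γ : unitInterval → ℝ × ℝ, Continuous γ ∧ Function.Injective γ ∧
    γ 0 = p ∧ γ 1 = q ∧ Set.range γ = A

/-- A plane drawing of a simple graph: vertices are distinct points of the plane, every edge `uv`
is an arc joining the points of `u` and `v`, an edge contains no vertex other than its two ends,
and two different edges meet only in vertices (so in common ends). -/
structure PlaneDrawing {V : Type*} (G : SimpleGraph V) where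
  /-- the point that represents a vertex -/
  pt : V → ℝ × ℝ
  /-- the set of points of an edge (its values outside the edge set of `G` are irrelevant) -/
  arc : Sym2 V → Set (ℝ × ℝ)
  pt_injective : Function.Injective pt
  isPlaneArc : ∀ u v : V, G.Adj u v → IsPlaneArc (arc s(u, v)) (pt u) (pt v)
  mem_of_pt_mem_arc : ∀ e ∈ G.edgeSet, ∀ w : V, pt w ∈ arc e → w ∈ e
  arc_inter_arc : ∀ e ∈ G.edgeSet, ∀ e' ∈ G.edgeSet, e ≠ e' → arc e ∩ arc e' ⊆ Set.range pt

/-- A graph is planar if it has a plane drawing. -/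
def IsPlanarGraph {V : Type*} (G : SimpleGraph V) : Prop :=
  Nonempty (PlaneDrawing G)

/-- `D` is an orientation of `G`: every edge of `G` gets exactly one of its two directions, and
`D` has no other arcs. -/
def IsOrientationOf {V : Type*} (D : Digraph V) (G : SimpleGraph V) : Prop :=
  (∀ u v : V, G.Adj u v ↔ D.Adj u v ∨ D.Adj v u) ∧ ∀ u v : V, D.Adj u v → ¬ D.Adj v u

/-- An `S`-labeling of `G`, for a set `S` of permutations of the `k` colours: an orientation of
`G` together with an element of `S` for each arc. -/
structure SLabeling {V : Type*} {k : ℕ} (S : Set (Equiv.Perm (Fin k))) (G : SimpleGraph V) where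
  /-- the orientation -/
  D : Digraph V
  isOrientationOf : IsOrientationOf D G
  /-- the permutation on the arc `(u, v)` -/
  σ : ∀ u v : V, D.Adj u v → S

/-- `f` is a proper `k`-colouring of the labeled graph `(D, σ)`: `σ_e (f x) ≠ f y` for each arc
`e = (x, y)`. -/
def SLabeling.IsProperColouring {V : Type*} {k : ℕ} {S : Set (Equiv.Perm (Fin k))}
    {G : SimpleGraph V} (L : SLabeling S G) (f : V → Fin k) : Prop :=
  ∀ (x y : V) (h : L.D.Adj x y), (L.σ x y h : Equiv.Perm (Fin k)) (f x) ≠ f y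

/-- `G` is `S`-`k`-colourable: every `S`-labeling of `G` has a proper `k`-colouring. -/
def IsSColourable {V : Type*} {k : ℕ} (S : Set (Equiv.Perm (Fin k))) (G : SimpleGraph V) : Prop :=
  ∀ L : SLabeling S G, ∃ f : V → Fin k, L.IsProperColouring f

/-- `S ⊆ S₄` is good if every (finite) planar graph is `S`-`4`-colourable. -/
def IsGoodSet (S : Set (Equiv.Perm (Fin 4))) : Prop :=
  ∀ (V : Type) [Finite V] (G : SimpleGraph V), IsPlanarGraph G → IsSColourable S G

/-- `S ⊆ S₄` is bad if it is not good. -/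
def IsBadSet (S : Set (Equiv.Perm (Fin 4))) : Prop :=
  ¬ IsGoodSet S

/-!
If `π ∈ S` is not the identity, then a planar graph with all labels in `{1, π}` and without a
proper colouring is enough. Recolouring by a fixed permutation replaces `π` by a conjugate, so `π`
may be taken to be one of `(0 1)`, `(0 1)(2 3)`, `(0 1 2)`, `(0 1 2 3)`.

For each of these four permutations there is a small labelled plane graph, a *gadget*, with two
terminals `0` and `1` on its outer face, joined by an arc with label the identity, such that certain
pairs of distinct colours on the terminals do not extend to a proper colouring of the gadget. The
graph without colouring consists of six copies of the gadget, one glued along each edge `ij`,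
`i < j`, of a complete graph on four *corners*. The forbidden pairs suffice for a contradiction:

* for `(0 1)`, the two colours `0` and `1` exclude each other at the terminals, so that the four
  corners have only the three classes `{0, 1}`, `{2}`, `{3}` at their disposal, each at most once;
* for `(0 1)(2 3)`, the same holds for the two classes `{0, 1}` and `{2, 3}`;
* for `(0 1 2)`, the pairs `(c, c + 1)` of colours in `ℤ/3` are forbidden. At least three corners
  `i < j < k` have a colour in `ℤ/3`; the colour drops by one from `i` to `j`, from `j` to `k`
  and also from `i` to `k`, which is absurd;
* for `(0 1 2 3)`, colours that differ by two are forbidden, so that adjacent corners have colours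
  of different parity, but there are triangles.

That a pair is forbidden is a finite search (`refutes`, `exists_not_respects_of_refutes`). Planarity is
shown by a drawing with straight segments between lattice points: the corners and the gadgets have
explicit coordinates, each gadget lies in its own triangle, and it is checked for every two
segments by signs of determinants that they meet in a common end or not at all
(`compatible_inter`).
-/

/-! ### Lists of labelled arcs -/

/-- An arc with one of two labels: the identity or, if `twisted` holds, a permutation `π` that is
a parameter of all notions that depend on it. -/
structure LabelledArc (α : Type*) where
  /-- the tail of the arc -/
  src : α
  /-- the head of the arc -/
  tgt : α
  /-- whether the label is `π` -/
  twisted : Bool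

namespace LabelledArc

variable {α β : Type*}

/-- The image of an arc under a map of the vertices. -/
def map (φ : α → β) (e : LabelledArc α) : LabelledArc β :=
  ⟨φ e.src, φ e.tgt, e.twisted⟩

/-- The label of an arc. -/
def perm (π : Equiv.Perm (Fin 4)) (e : LabelledArc α) : Equiv.Perm (Fin 4) :=
  if e.twisted then π else 1

/-- The colouring `f` satisfies the condition that the arc `e` imposes. -/
def Respects (π : Equiv.Perm (Fin 4)) (f : α → Fin 4) (e : LabelledArc α) : Prop :=
  e.perm π (f e.src) ≠ f e.tgt

instance (π : Equiv.Perm (Fin 4)) (f : α → Fin 4) (e : LabelledArc α) :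
    Decidable (e.Respects π f) :=
  inferInstanceAs (Decidable (_ ≠ _))

theorem respects_map {π : Equiv.Perm (Fin 4)} {φ : α → β} {f : β → Fin 4} {e : LabelledArc α} :
    (e.map φ).Respects π f ↔ e.Respects π (f ∘ φ) :=
  Iff.rfl

/-- Recolouring by `τ⁻¹` turns the label `π` into `τ⁻¹ * π * τ`. -/
theorem Respects.conj {π : Equiv.Perm (Fin 4)} {f : α → Fin 4} {e : LabelledArc α}
    (h : e.Respects π f) (τ : Equiv.Perm (Fin 4)) :
    e.Respects (τ⁻¹ * π * τ) (fun v => τ⁻¹ (f v)) := by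
  unfold Respects perm at *
  split_ifs at h ⊢ <;> simpa using h

end LabelledArc

open LabelledArc

/-! ### Straight segments between lattice points -/

/-- The lattice point `c` lies strictly to the left of the directed line from `a` to `b`. This
is the positivity of a determinant, with its negative terms moved to the other side so that the
computation stays in `ℕ`. -/
def isLeft (a b c : ℕ × ℕ) : Bool :=
  Nat.blt (a.1 * c.2 + b.1 * a.2 + c.1 * b.2) (a.1 * b.2 + b.1 * c.2 + c.1 * a.2)

/-- The points `c` and `d` lie strictly on the same side of the line through `a` and `b`. -/
def sameSide (a b c d : ℕ × ℕ) : Bool :=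
  (isLeft a b c && isLeft a b d) || (isLeft b a c && isLeft b a d)

/-- The points `a`, `b`, `c` are not collinear. -/
def offLine (a b c : ℕ × ℕ) : Bool :=
  isLeft a b c || isLeft b a c

/-- Equality of lattice points, in a form that evaluates quickly. -/
def samePoint (a b : ℕ × ℕ) : Bool :=
  Nat.beq a.1 b.1 && Nat.beq a.2 b.2

/-- A sufficient condition for the segments `ab` and `cd` to meet at most in a common end: the line
through one of them avoids the other, or they share one end and have different directions. -/
def compatible (a b c d : ℕ × ℕ) : Bool :=
  sameSide a b c d || sameSide c d a b ||
    (samePoint a c && offLine a b d) || (samePoint a d && offLine a b c) ||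
    (samePoint b c && offLine b a d) || (samePoint b d && offLine b a c)

/-- A lattice point as a point of the real plane. -/
def toPlane (p : ℕ × ℕ) : ℝ × ℝ := (p.1, p.2)

theorem toPlane_injective : Function.Injective toPlane := by
  intro p q h
  simpa [toPlane, Prod.ext_iff] using h

/-- Twice the signed area of the triangle `abx`. -/
def signedArea (a b x : ℝ × ℝ) : ℝ :=
  (b.1 - a.1) * (x.2 - a.2) - (b.2 - a.2) * (x.1 - a.1)

theorem signedArea_swap (a b x : ℝ × ℝ) : signedArea b a x = -signedArea a b x := by
  simp only [signedArea]; ring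

theorem isLeft_iff {a b c : ℕ × ℕ} :
    isLeft a b c ↔ 0 < signedArea (toPlane a) (toPlane b) (toPlane c) := by
  rw [isLeft, Nat.blt_eq, ← Nat.cast_lt (α := ℝ)]
  simp only [signedArea, toPlane]
  push_cast
  constructor <;> intro h <;> linarith

/-- On a segment the signed area interpolates linearly between its values at the ends. -/
theorem signedArea_combo (a b c d : ℝ × ℝ) {s t : ℝ} (hst : s + t = 1) :
    signedArea a b (s • c + t • d) = s * signedArea a b c + t * signedArea a b d := by
  obtain rfl : s = 1 - t := by linarith
  simp only [signedArea, Prod.fst_add, Prod.snd_add, Prod.smul_fst, Prod.smul_snd, smul_eq_mul]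
  ring

theorem signedArea_eq_zero {a b x : ℝ × ℝ} (hx : x ∈ segment ℝ a b) : signedArea a b x = 0 := by
  obtain ⟨s, t, -, -, hst, rfl⟩ := hx
  rw [signedArea_combo _ _ _ _ hst]
  simp only [signedArea]; ring

theorem signedArea_pos {a b c d x : ℝ × ℝ} (hc : 0 < signedArea a b c)
    (hd : 0 < signedArea a b d) (hx : x ∈ segment ℝ c d) : 0 < signedArea a b x := by
  obtain ⟨s, t, hs, ht, hst, rfl⟩ := hx
  rw [signedArea_combo _ _ _ _ hst]
  rcases hs.eq_or_lt with rfl | hs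
  · obtain rfl : t = 1 := by linarith
    simpa using hd
  · have := mul_pos hs hc
    have := mul_nonneg ht hd.le
    linarith

theorem sameSide_disjoint {a b c d : ℕ × ℕ} (h : sameSide a b c d) {x : ℝ × ℝ}
    (hx : x ∈ segment ℝ (toPlane a) (toPlane b)) : x ∉ segment ℝ (toPlane c) (toPlane d) := by
  intro hx'
  simp only [sameSide, Bool.or_eq_true, Bool.and_eq_true, isLeft_iff] at h
  rcases h with ⟨hc, hd⟩ | ⟨hc, hd⟩
  · exact (signedArea_pos hc hd hx').ne' (signedArea_eq_zero hx)
  · rw [segment_symm] at hx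
    exact (signedArea_pos hc hd hx').ne' (signedArea_eq_zero hx)

theorem offLine_inter {o p q : ℕ × ℕ} (h : offLine o p q) {x : ℝ × ℝ}
    (hx : x ∈ segment ℝ (toPlane o) (toPlane p)) (hx' : x ∈ segment ℝ (toPlane o) (toPlane q)) :
    x = toPlane o := by
  have h0 : signedArea (toPlane o) (toPlane p) (toPlane q) ≠ 0 := by
    simp only [offLine, Bool.or_eq_true, isLeft_iff, signedArea_swap (toPlane o)] at h
    rcases h with h | h
    · exact h.ne'
    · linarith
  have hz := signedArea_eq_zero hx
  obtain ⟨s, t, -, -, hst, rfl⟩ := hx'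
  rw [signedArea_combo _ _ _ _ hst,
    signedArea_eq_zero (left_mem_segment ℝ (toPlane o) (toPlane p)), mul_zero, zero_add] at hz
  obtain rfl : t = 0 := (mul_eq_zero.1 hz).resolve_right h0
  obtain rfl : s = 1 := by linarith
  simp

theorem offLine_ne {a b c : ℕ × ℕ} (h : offLine a b c) : b ≠ c := by
  rintro rfl
  simp only [offLine, isLeft, Bool.or_eq_true, Nat.blt_eq] at h
  omega

theorem samePoint_iff {a b : ℕ × ℕ} : samePoint a b ↔ a = b := by
  simp [samePoint, Prod.ext_iff]

theorem compatible_inter {a b c d : ℕ × ℕ} (h : compatible a b c d) {x : ℝ × ℝ}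
    (hx : x ∈ segment ℝ (toPlane a) (toPlane b)) (hx' : x ∈ segment ℝ (toPlane c) (toPlane d)) :
    ∃ o, (o = a ∨ o = b) ∧ (o = c ∨ o = d) ∧ x = toPlane o := by
  simp only [compatible, Bool.or_eq_true, Bool.and_eq_true, samePoint_iff] at h
  rcases h with ((((h | h) | ⟨rfl, h⟩) | ⟨rfl, h⟩) | ⟨rfl, h⟩) | ⟨rfl, h⟩
  · exact (sameSide_disjoint h hx hx').elim
  · exact (sameSide_disjoint h hx' hx).elim
  · exact ⟨a, .inl rfl, .inl rfl, offLine_inter h hx hx'⟩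
  · rw [segment_symm] at hx'
    exact ⟨a, .inl rfl, .inr rfl, offLine_inter h hx hx'⟩
  · rw [segment_symm] at hx
    exact ⟨b, .inr rfl, .inl rfl, offLine_inter h hx hx'⟩
  · rw [segment_symm] at hx hx'
    exact ⟨b, .inr rfl, .inr rfl, offLine_inter h hx hx'⟩

/-- Compatible segments do not have the same two ends. -/
theorem compatible_ends {a b c d : ℕ × ℕ} (hab : a ≠ b) (h : compatible a b c d) :
    ¬ (a = c ∧ b = d) ∧ ¬ (a = d ∧ b = c) := by
  constructor <;> rintro ⟨rfl, rfl⟩ <;>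
    simp only [compatible, Bool.or_eq_true, Bool.and_eq_true, samePoint_iff] at h <;>
    rcases h with ((((h | h) | ⟨h', h⟩) | ⟨h', h⟩) | ⟨h', h⟩) | ⟨h', h⟩
  all_goals first
    | exact hab h'
    | exact hab h'.symm
    | exact offLine_ne h rfl
    -- the segments have a point in common
    | exact sameSide_disjoint h (left_mem_segment ..) (left_mem_segment ..)
    | exact sameSide_disjoint h (left_mem_segment ..) (right_mem_segment ..)

theorem isPlaneArc_segment {p q : ℝ × ℝ} (h : p ≠ q) : IsPlaneArc (segment ℝ p q) p q := by
  refine ⟨fun t => AffineMap.lineMap p q (t : ℝ), ?_, ?_, by simp, by simp, ?_⟩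
  · exact (AffineMap.lineMap_continuous (R := ℝ)).comp continuous_subtype_val
  · exact (AffineMap.lineMap_injective ℝ h).comp Subtype.val_injective
  · rw [segment_eq_image_lineMap, ← Subtype.range_coe (s := Set.Icc (0 : ℝ) 1), ← Set.range_comp]
    rfl

/-! ### The labelled plane graph of a list of arcs -/

/-- The arcs of the list, drawn as straight segments, form a plane graph. -/
def isPlane : List (LabelledArc (ℕ × ℕ)) → Bool
  | [] => true
  | e :: E => !samePoint e.src e.tgt &&
      E.all (fun e' => compatible e.src e.tgt e'.src e'.tgt) && isPlane E

theorem isPlane_iff {E : List (LabelledArc (ℕ × ℕ))} :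
    isPlane E ↔ (∀ e ∈ E, e.src ≠ e.tgt) ∧
      E.Pairwise fun e e' => compatible e.src e.tgt e'.src e'.tgt := by
  induction E with
  | nil => simp [isPlane]
  | cons e E ih =>
    simp only [isPlane, Bool.and_eq_true, ih, List.all_eq_true, Bool.not_eq_true',
      ← Bool.not_eq_true, samePoint_iff, List.mem_cons, forall_eq_or_imp, List.pairwise_cons]
    tauto

section ArcList

variable (E : List (LabelledArc (ℕ × ℕ)))

/-- The ends of the arcs of a list. Since there are no isolated vertices, a condition on pairs of
arcs is enough to control the position of all vertices. -/
abbrev Ends : Type := {p : ℕ × ℕ // ∃ e ∈ E, p = e.src ∨ p = e.tgt}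

instance : Finite (Ends E) := by
  refine Set.Finite.subset (s := ⋃ e ∈ {e | e ∈ E}, {e.src, e.tgt}) ?_ ?_
  · exact (List.finite_toSet E).biUnion fun e _ => Set.toFinite _
  · rintro p ⟨e, he, hp⟩
    exact Set.mem_biUnion he hp

/-- The list of arcs as a directed graph. -/
def arcDigraph : Digraph (Ends E) where
  Adj u v := ∃ e ∈ E, e.src = u ∧ e.tgt = v

/-- The undirected graph under `arcDigraph`. -/
def arcGraph : SimpleGraph (Ends E) := SimpleGraph.fromRel (arcDigraph E).Adj

variable {E}

theorem exists_arc_of_adj {u v : Ends E} (h : (arcGraph E).Adj u v) :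
    ∃ e ∈ E, (e.src = u ∧ e.tgt = v) ∨ (e.src = v ∧ e.tgt = u) := by
  obtain ⟨-, ⟨e, he, h⟩ | ⟨e, he, h⟩⟩ := h
  · exact ⟨e, he, .inl h⟩
  · exact ⟨e, he, .inr h⟩

theorem arc_inter (hE : isPlane E) {e e' : LabelledArc (ℕ × ℕ)} (he : e ∈ E) (he' : e' ∈ E)
    (hne : e ≠ e') {x : ℝ × ℝ} (hx : x ∈ segment ℝ (toPlane e.src) (toPlane e.tgt))
    (hx' : x ∈ segment ℝ (toPlane e'.src) (toPlane e'.tgt)) :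
    ∃ o, (o = e.src ∨ o = e.tgt) ∧ (o = e'.src ∨ o = e'.tgt) ∧ x = toPlane o := by
  let R : LabelledArc (ℕ × ℕ) → LabelledArc (ℕ × ℕ) → Prop := fun e e' =>
    compatible e.src e.tgt e'.src e'.tgt ∨ compatible e'.src e'.tgt e.src e.tgt
  have hR : E.Pairwise R := (isPlane_iff.1 hE).2.imp fun h => .inl h
  have : Std.Symm R := ⟨fun _ _ h => h.symm⟩
  rcases hR.forall he he' hne with h | h
  · exact compatible_inter h hx hx'
  · obtain ⟨o, h1, h2, h3⟩ := compatible_inter h hx' hx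
    exact ⟨o, h2, h1, h3⟩

theorem arc_unique (hE : isPlane E) {e e' : LabelledArc (ℕ × ℕ)} (he : e ∈ E) (he' : e' ∈ E)
    (h : (e.src = e'.src ∧ e.tgt = e'.tgt) ∨ (e.src = e'.tgt ∧ e.tgt = e'.src)) : e = e' := by
  by_contra hne
  obtain ⟨hloop, hpair⟩ := isPlane_iff.1 hE
  let R : LabelledArc (ℕ × ℕ) → LabelledArc (ℕ × ℕ) → Prop := fun e e' =>
    ¬ ((e.src = e'.src ∧ e.tgt = e'.tgt) ∨ (e.src = e'.tgt ∧ e.tgt = e'.src))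
  have : Std.Symm R := ⟨fun a b hab => by simp only [R] at hab ⊢; grind⟩
  have hR : E.Pairwise R := hpair.imp_of_mem fun ha _ h =>
    not_or.2 (compatible_ends (hloop _ ha) h)
  exact hR.forall he he' hne h

theorem mem_segment_arc {e : LabelledArc (ℕ × ℕ)} {p : ℕ × ℕ} (h : p = e.src ∨ p = e.tgt) :
    toPlane p ∈ segment ℝ (toPlane e.src) (toPlane e.tgt) := by
  rcases h with rfl | rfl
  · exact left_mem_segment ..
  · exact right_mem_segment ..

/-- The segment of an edge. -/
noncomputable def edgeSegment (e : Sym2 (Ends E)) : Set (ℝ × ℝ) :=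
  Sym2.lift ⟨fun u v => segment ℝ (toPlane u.1) (toPlane v.1), fun _ _ => segment_symm ..⟩ e

theorem edgeSegment_eq {e : Sym2 (Ends E)} (he : e ∈ (arcGraph E).edgeSet) :
    ∃ a ∈ E, edgeSegment e = segment ℝ (toPlane a.src) (toPlane a.tgt) ∧
      (∀ w : Ends E, w ∈ e ↔ w.1 = a.src ∨ w.1 = a.tgt) := by
  induction e with
  | h u v =>
    obtain ⟨a, ha, ⟨h1, h2⟩ | ⟨h1, h2⟩⟩ := exists_arc_of_adj he
    · exact ⟨a, ha, by simp [edgeSegment, h1, h2], fun w => by simp [h1, h2, Subtype.ext_iff]⟩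
    · refine ⟨a, ha, ?_, fun w => by simp [h1, h2, Subtype.ext_iff, or_comm]⟩
      rw [segment_symm]
      simp [edgeSegment, h1, h2]

theorem isPlanarGraph_arcGraph (hE : isPlane E) : IsPlanarGraph (arcGraph E) := by
  refine ⟨⟨fun v => toPlane v.1, edgeSegment, fun u v h => Subtype.ext (toPlane_injective h),
    ?_, ?_, ?_⟩⟩
  · intro u v h
    exact isPlaneArc_segment fun h' => h.ne (Subtype.ext (toPlane_injective h'))
  · intro e he w hw
    obtain ⟨a, ha, hseg, hmem⟩ := edgeSegment_eq he
    rw [hmem]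
    obtain ⟨b, hb, hwb⟩ := w.2
    by_cases hab : a = b
    · exact hab ▸ hwb
    · obtain ⟨o, ho, -, hwo⟩ := arc_inter hE ha hb hab (hseg ▸ hw) (mem_segment_arc hwb)
      exact toPlane_injective hwo ▸ ho
  · intro e he e' he' hne x hx
    obtain ⟨a, ha, hseg, hmem⟩ := edgeSegment_eq he
    obtain ⟨a', ha', hseg', hmem'⟩ := edgeSegment_eq he'
    have haa : a ≠ a' := by
      rintro rfl
      exact hne (Sym2.ext fun w => by rw [hmem, hmem'])
    obtain ⟨o, ho, -, rfl⟩ := arc_inter hE ha ha' haa (hseg ▸ hx.1) (hseg' ▸ hx.2)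
    exact ⟨⟨o, a, ha, ho⟩, rfl⟩

theorem isOrientationOf_arcDigraph (hE : isPlane E) :
    IsOrientationOf (arcDigraph E) (arcGraph E) := by
  have hloop := (isPlane_iff.1 hE).1
  refine ⟨fun u v => ⟨fun h => h.2, fun h => ⟨?_, h⟩⟩, ?_⟩
  · rintro rfl
    rcases h with ⟨e, he, h1, h2⟩ | ⟨e, he, h1, h2⟩ <;> exact hloop e he (h1.trans h2.symm)
  · rintro u v ⟨e, he, h1, h2⟩ ⟨e', he', h1', h2'⟩
    obtain rfl := arc_unique hE he he' (.inr ⟨h1.trans h2'.symm, h2.trans h1'.symm⟩)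
    exact hloop e he (h1.trans h2'.symm)

/-- A list of arcs without crossings, with labels in `{1, π}` and without a proper colouring,
shows that every `S` that contains `1` and `π` is bad. -/
theorem isBadSet_of_arcs {S : Set (Equiv.Perm (Fin 4))} {π : Equiv.Perm (Fin 4)} (h1 : 1 ∈ S)
    (hπ : π ∈ S) (hE : isPlane E) (hno : ∀ f : ℕ × ℕ → Fin 4, ∃ e ∈ E, ¬ e.Respects π f) :
    IsBadSet S := by
  intro hgood
  have hS : ∀ e : LabelledArc (ℕ × ℕ), e.perm π ∈ S := fun e => by
    unfold perm; split_ifs <;> assumption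
  let L : SLabeling S (arcGraph E) :=
    { D := arcDigraph E
      isOrientationOf := isOrientationOf_arcDigraph hE
      σ := fun u v h => ⟨h.choose.perm π, hS _⟩ }
  obtain ⟨f, hf⟩ := hgood (Ends E) (arcGraph E) (isPlanarGraph_arcGraph hE) L
  classical
  -- the values of the extended colouring outside the graph are irrelevant
  obtain ⟨e, he, hbad⟩ := hno fun p => if h : ∃ e ∈ E, p = e.src ∨ p = e.tgt then f ⟨p, h⟩ else 0
  have hs : ∃ e' ∈ E, e.src = e'.src ∨ e.src = e'.tgt := ⟨e, he, .inl rfl⟩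
  have ht : ∃ e' ∈ E, e.tgt = e'.src ∨ e.tgt = e'.tgt := ⟨e, he, .inr rfl⟩
  have hadj : (arcDigraph E).Adj ⟨e.src, hs⟩ ⟨e.tgt, ht⟩ := ⟨e, he, rfl, rfl⟩
  have hchoose : hadj.choose = e :=
    arc_unique hE hadj.choose_spec.1 he (.inl hadj.choose_spec.2)
  apply hbad
  have := hf _ _ hadj
  simp only [L, hchoose] at this
  simpa only [Respects, dif_pos hs, dif_pos ht] using this

end ArcList

/-! ### Gadgets on the edges of a complete graph -/

/-- A labelled graph on an initial segment of `ℕ` with terminals `0` and `1`, drawn in a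
triangle. -/
structure Gadget where
  /-- the sum of the barycentric coordinates of each vertex -/
  scale : ℕ
  /-- integral barycentric coordinates of the vertices; the terminals are to be at the first two
  vertices of the triangle -/
  pos : List (ℕ × ℕ × ℕ)
  /-- the arcs -/
  arcs : List (LabelledArc ℕ)
  /-- pairs of colours that cannot appear at the terminals -/
  forbidden : List (Fin 4 × Fin 4)

/-- The place of a copy of a gadget: the numbers of the corners of the complete graph that the
terminals go to, and the third vertex of the triangle that the copy is drawn in. -/
structure Place where
  /-- the corner of terminal `0` -/
  fst : Fin 4
  /-- the corner of terminal `1` -/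
  snd : Fin 4
  /-- the third vertex of the triangle -/
  apex : ℕ × ℕ

/-- The corners of a plane drawing of the complete graph on four vertices. -/
def corner : Fin 4 → ℕ × ℕ := ![(0, 0), (8, 0), (5, 8), (5, 2)]

/-- One place on each edge of the complete graph, directed upwards. The six triangles meet in
corners only. -/
def places : List Place :=
  [⟨0, 1, (6, 1)⟩, ⟨0, 2, (4, 3)⟩, ⟨0, 3, (4, 2)⟩, ⟨1, 2, (6, 5)⟩, ⟨1, 3, (7, 1)⟩, ⟨2, 3, (6, 3)⟩]

/-- The combination of three lattice points with weights `w`. -/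
def weighted (a b c : ℕ × ℕ) (w : ℕ × ℕ × ℕ) : ℕ × ℕ :=
  (w.1 * a.1 + w.2.1 * b.1 + w.2.2 * c.1, w.1 * a.2 + w.2.1 * b.2 + w.2.2 * c.2)

/-- A search by backtracking. The value `true` means that the colouring of the vertices below `k`
by `f` does not extend to a proper colouring of the vertices below `k + m`. An arc is tested as soon
as both ends are coloured, that is, when its larger end has just got its colour. -/
def refutes (π : Equiv.Perm (Fin 4)) (A : List (LabelledArc ℕ)) : ℕ → ℕ → (ℕ → Fin 4) → Bool
  | 0, k, f => A.any fun e => Nat.beq (max e.src e.tgt + 1) k && !decide (e.Respects π f)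
  | m + 1, k, f => (A.any fun e => Nat.beq (max e.src e.tgt + 1) k && !decide (e.Respects π f)) ||
      [0, 1, 2, 3].all fun c => refutes π A m (k + 1) (Function.update f k c)

theorem exists_not_respects_of_any {π : Equiv.Perm (Fin 4)} {A : List (LabelledArc ℕ)} {k : ℕ}
    {f g : ℕ → Fin 4}
    (h : A.any fun e => Nat.beq (max e.src e.tgt + 1) k && !decide (e.Respects π f))
    (hfg : ∀ i < k, g i = f i) : ∃ e ∈ A, ¬ e.Respects π g := by
  simp only [List.any_eq_true, Bool.and_eq_true, Nat.beq_eq, Bool.not_eq_true',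
    decide_eq_false_iff_not] at h
  obtain ⟨e, he, rfl, hbad⟩ := h
  refine ⟨e, he, ?_⟩
  unfold Respects at hbad ⊢
  rwa [hfg e.src (by omega), hfg e.tgt (by omega)]

/-- Soundness of the backtracking search. -/
theorem exists_not_respects_of_refutes {π : Equiv.Perm (Fin 4)} {A : List (LabelledArc ℕ)}
    {g : ℕ → Fin 4} {m k : ℕ} {f : ℕ → Fin 4} (h : refutes π A m k f)
    (hfg : ∀ i < k, g i = f i) : ∃ e ∈ A, ¬ e.Respects π g := by
  induction m generalizing k f with
  | zero => exact exists_not_respects_of_any h hfg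
  | succ m ih =>
    rw [refutes, Bool.or_eq_true, List.all_eq_true] at h
    rcases h with h | h
    · exact exists_not_respects_of_any h hfg
    · refine ih (h (g k) ?_) fun i hi => ?_
      · generalize g k = c
        fin_cases c <;> simp
      · rcases eq_or_ne i k with rfl | hik
        · simp
        · rw [Function.update_of_ne hik, hfg i (by omega)]

namespace Gadget

variable (g : Gadget)

/-- The position of a vertex in the copy of a gadget at a place. -/
def place (P : Place) (v : ℕ) : ℕ × ℕ :=
  weighted (corner P.fst) (corner P.snd) P.apex (g.pos.getD v 0)

/-- The arcs of the copies of a gadget at all places. -/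
def complete : List (LabelledArc (ℕ × ℕ)) :=
  places.flatMap fun P => g.arcs.map (LabelledArc.map (g.place P))

/-- A gadget that is drawn without crossings at the six places, for which the pairs of colours
listed as forbidden are so, and for which this list leaves no colouring of the corners. -/
structure Works (π : Equiv.Perm (Fin 4)) : Prop where
  pos_zero : g.pos.getD 0 0 = (g.scale, 0, 0)
  pos_one : g.pos.getD 1 0 = (0, g.scale, 0)
  isPlane_complete : isPlane g.complete
  refutes_of_mem : ∀ p ∈ g.forbidden,
    refutes π g.arcs (g.pos.length - 2) 2 fun i => if i = 0 then p.1 else p.2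
  exists_forbidden : ∀ c : Fin 4 → Fin 4, ∃ P ∈ places, (c P.fst, c P.snd) ∈ g.forbidden

variable {g}

theorem Works.exists_not_respects {π : Equiv.Perm (Fin 4)} (hg : g.Works π)
    (f : ℕ × ℕ → Fin 4) : ∃ e ∈ g.complete, ¬ e.Respects π f := by
  -- the copies have the corners, scaled, as their common vertices
  obtain ⟨P, hP, hmem⟩ := hg.exists_forbidden fun i => f (weighted (corner i) 0 0 (g.scale, 0, 0))
  obtain ⟨e, he, hbad⟩ := exists_not_respects_of_refutes (g := f ∘ g.place P)
    (hg.refutes_of_mem _ hmem) (by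
      intro i hi
      interval_cases i
      · simp only [Function.comp_apply, place, hg.pos_zero]
        simp [weighted]
      · simp only [Function.comp_apply, place, hg.pos_one]
        simp [weighted])
  exact ⟨e.map (g.place P), List.mem_flatMap.2 ⟨P, hP, List.mem_map_of_mem he⟩,
    fun h => hbad (respects_map.1 h)⟩

/-- A gadget for one permutation serves for all of its conjugates. -/
theorem Works.isBadSet {π τ : Equiv.Perm (Fin 4)} (hg : g.Works (τ⁻¹ * π * τ))
    {S : Set (Equiv.Perm (Fin 4))} (h1 : 1 ∈ S) (hπ : π ∈ S) : IsBadSet S := by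
  refine isBadSet_of_arcs h1 hπ hg.isPlane_complete fun f => ?_
  obtain ⟨e, he, hbad⟩ := hg.exists_not_respects fun p => τ⁻¹ (f p)
  exact ⟨e, he, fun h => hbad (h.conj τ)⟩

end Gadget

/-! ### The four gadgets -/

/-- A gadget for the transposition `(0 1)`: the terminals have different colours that are not both
in `{0, 1}`. -/
def transpositionGadget : Gadget where
  scale := 12
  pos :=
    [(12, 0, 0), (0, 12, 0), (0, 0, 12), (5, 2, 5), (2, 3, 7), (4, 5, 3), (6, 4, 2),
     (4, 7, 1), (7, 4, 1), (2, 8, 2)]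
  arcs :=
    [⟨0, 1, false⟩, ⟨0, 2, false⟩, ⟨1, 2, false⟩, ⟨0, 3, true⟩, ⟨2, 3, false⟩, ⟨1, 4, false⟩,
     ⟨2, 4, true⟩, ⟨3, 4, false⟩, ⟨3, 5, false⟩, ⟨4, 5, false⟩, ⟨0, 6, true⟩, ⟨3, 6, false⟩,
     ⟨5, 6, true⟩, ⟨1, 7, false⟩, ⟨5, 7, true⟩, ⟨6, 7, false⟩, ⟨0, 8, false⟩, ⟨1, 8, false⟩,
     ⟨6, 8, false⟩, ⟨7, 8, false⟩, ⟨1, 9, true⟩, ⟨4, 9, true⟩, ⟨5, 9, false⟩, ⟨7, 9, true⟩]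
  forbidden :=
    [(0, 0), (0, 1), (1, 0), (1, 1), (2, 2), (3, 3)]

open Equiv in
theorem works_transpositionGadget : transpositionGadget.Works (swap 0 1) where
  pos_zero := rfl
  pos_one := rfl
  isPlane_complete := by decide +kernel
  refutes_of_mem := by decide +kernel
  exists_forbidden := by decide +kernel

/-- A gadget for `(0 1)(2 3)`: the terminals have colours in different sets of `{0, 1}`, `{2, 3}`.
The vertices `10`, `11`, `12` and `13`, `14`, `15` make octahedra with the triangles `3`, `6`, `8`
and `7`, `8`, `9`; they ensure that the colours of each of these triangles meet both sets. -/
def doubleTranspositionGadget : Gadget where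
  scale := 42
  pos :=
    [(42, 0, 0), (0, 42, 0), (29, 11, 2), (22, 10, 10), (12, 22, 8), (0, 0, 42), (13, 11, 18),
     (7, 19, 16), (13, 16, 13), (8, 22, 12), (16, 11, 15), (16, 12, 14), (15, 12, 15),
     (9, 20, 13), (8, 20, 14), (9, 19, 14)]
  arcs :=
    [⟨0, 1, false⟩, ⟨0, 2, true⟩, ⟨1, 2, true⟩, ⟨0, 3, false⟩, ⟨2, 3, true⟩, ⟨1, 4, false⟩,
     ⟨2, 4, false⟩, ⟨3, 4, true⟩, ⟨0, 5, true⟩, ⟨1, 5, true⟩, ⟨0, 6, true⟩, ⟨3, 6, true⟩,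
     ⟨5, 6, true⟩, ⟨1, 7, true⟩, ⟨5, 7, false⟩, ⟨6, 7, true⟩, ⟨3, 8, true⟩, ⟨4, 8, false⟩,
     ⟨6, 8, true⟩, ⟨7, 8, false⟩, ⟨1, 9, false⟩, ⟨4, 9, false⟩, ⟨7, 9, true⟩, ⟨8, 9, false⟩,
     ⟨3, 10, false⟩, ⟨6, 10, true⟩, ⟨3, 11, true⟩, ⟨8, 11, false⟩, ⟨10, 11, false⟩,
     ⟨6, 12, false⟩, ⟨8, 12, true⟩, ⟨10, 12, false⟩, ⟨11, 12, false⟩, ⟨8, 13, false⟩,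
     ⟨9, 13, false⟩, ⟨7, 14, false⟩, ⟨9, 14, true⟩, ⟨13, 14, false⟩, ⟨7, 15, false⟩,
     ⟨8, 15, false⟩, ⟨13, 15, false⟩, ⟨14, 15, false⟩]
  forbidden :=
    [(0, 0), (0, 1), (1, 0), (1, 1), (2, 2), (2, 3), (3, 2), (3, 3)]

open Equiv in
theorem works_doubleTranspositionGadget :
    doubleTranspositionGadget.Works (swap 0 1 * swap 2 3) where
  pos_zero := rfl
  pos_one := rfl
  isPlane_complete := by decide +kernel
  refutes_of_mem := by decide +kernel
  exists_forbidden := by decide +kernel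

/-- A gadget for the three-cycle `(0 1 2)`: if both terminals have colours in `{0, 1, 2}`, then the
second colour is the predecessor of the first in the cycle. -/
def threeCycleGadget : Gadget where
  scale := 31
  pos :=
    [(31, 0, 0), (0, 31, 0), (0, 0, 31), (9, 10, 12), (6, 4, 21), (5, 8, 18), (13, 14, 4),
     (14, 14, 3), (21, 8, 2), (19, 11, 1)]
  arcs :=
    [⟨0, 1, false⟩, ⟨0, 2, false⟩, ⟨1, 2, true⟩, ⟨0, 3, true⟩, ⟨1, 3, true⟩, ⟨0, 4, false⟩,
     ⟨2, 4, false⟩, ⟨4, 3, true⟩, ⟨1, 5, true⟩, ⟨2, 5, false⟩, ⟨3, 5, false⟩, ⟨4, 5, false⟩,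
     ⟨0, 6, true⟩, ⟨1, 6, true⟩, ⟨3, 6, true⟩, ⟨7, 1, true⟩, ⟨6, 7, true⟩, ⟨8, 0, true⟩,
     ⟨6, 8, true⟩, ⟨7, 8, true⟩, ⟨9, 0, true⟩, ⟨9, 1, true⟩, ⟨9, 7, true⟩, ⟨8, 9, true⟩]
  forbidden :=
    [(0, 0), (1, 1), (2, 2), (3, 3), (0, 1), (1, 2), (2, 0)]

open Equiv in
theorem works_threeCycleGadget : threeCycleGadget.Works (swap 0 1 * swap 1 2) where
  pos_zero := rfl
  pos_one := rfl
  isPlane_complete := by decide +kernel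
  refutes_of_mem := by decide +kernel
  exists_forbidden := by decide +kernel

/-- A gadget for the four-cycle `(0 1 2 3)`: the colours of the terminals have different parity. -/
def fourCycleGadget : Gadget where
  scale := 12
  pos :=
    [(12, 0, 0), (0, 12, 0), (4, 5, 3), (4, 6, 2), (7, 4, 1), (5, 6, 1), (0, 0, 12),
     (1, 3, 8), (3, 3, 6)]
  arcs :=
    [⟨0, 1, false⟩, ⟨0, 2, true⟩, ⟨1, 2, true⟩, ⟨1, 3, true⟩, ⟨2, 3, false⟩, ⟨4, 0, true⟩,
     ⟨2, 4, false⟩, ⟨3, 4, false⟩, ⟨0, 5, true⟩, ⟨1, 5, false⟩, ⟨5, 3, true⟩, ⟨5, 4, true⟩,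
     ⟨0, 6, false⟩, ⟨1, 6, false⟩, ⟨1, 7, false⟩, ⟨2, 7, false⟩, ⟨6, 7, false⟩, ⟨0, 8, true⟩,
     ⟨8, 2, true⟩, ⟨8, 6, true⟩, ⟨8, 7, true⟩]
  forbidden :=
    [(0, 0), (0, 2), (1, 1), (1, 3), (2, 0), (2, 2), (3, 1), (3, 3)]

open Equiv in
theorem works_fourCycleGadget : fourCycleGadget.Works (finRotate 4) where
  pos_zero := rfl
  pos_one := rfl
  isPlane_complete := by decide +kernel
  refutes_of_mem := by decide +kernel
  exists_forbidden := by decide +kernel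

/-! ### Conjugacy classes -/

open Equiv in
theorem exists_conj_mem_representatives : ∀ π : Perm (Fin 4), π ≠ 1 → ∃ τ : Perm (Fin 4),
    τ⁻¹ * π * τ = swap 0 1 ∨ τ⁻¹ * π * τ = swap 0 1 * swap 2 3 ∨
      τ⁻¹ * π * τ = swap 0 1 * swap 1 2 ∨ τ⁻¹ * π * τ = finRotate 4 := by
  decide +kernel

theorem theorem2 (S : Set (Equiv.Perm (Fin 4))) (hid : (1 : Equiv.Perm (Fin 4)) ∈ S)
    (hS : S ≠ {1}) : IsBadSet S := by
  obtain ⟨π, hπ, hne⟩ : ∃ π ∈ S, π ≠ 1 := by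
    by_contra! h
    exact hS (Set.eq_singleton_iff_unique_mem.2 ⟨hid, h⟩)
  obtain ⟨τ, h | h | h | h⟩ := exists_conj_mem_representatives π hne
  · exact (h ▸ works_transpositionGadget).isBadSet hid hπ
  · exact (h ▸ works_doubleTranspositionGadget).isBadSet hid hπ
  · exact (h ▸ works_threeCycleGadget).isBadSet hid hπ
  · exact (h ▸ works_fourCycleGadget).isBadSet hid hπ
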